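/- Let $(\Omega,\mathcal F,\mathbb P)$ be a probability space with a filtration $(\mathcal F_t)_{t\ge 0}$, let $B$ be an $r$-dimensional Brownian motion with respect to $(\mathcal F_t)_{t\ge0}$, and let $\xi:\Omega\to\mathbb R^d$ be $\mathcal F_0$-measurable with $\mathbb E\|\xi\|^q<\infty$ for all $q\in[1,\infty)$. Let $\mu:\mathbb R^d\times\mathbb R^d\to\mathbb R^d$ be continuously differentiable and $\sigma:\mathbb R^d\times\mathbb R^d\to\mathbb R^{d\times r}$, and assume that there are constants $K,c\ge 0$ such that for all $x,y,x_1,x_2,y_1,y_2\in\mathbb R^d$ $$\|\sigma(x_1,y_1)-\sigma(x_2,y_2)\|\le K(\|x_1-x_2\|+\|y_1-y_2\|),\qquad \langle x_1-x_2,\mu(x_1,y)-\mu(x_2,y)\rangle\le K\|x_1-x_2\|^2,$$ $$\|\mu(x,y_1)-\mu(x,y_2)\|\le K\|y_1-y_2\|,\qquad \|\mu_x(x,y)\|\le K(1+\|x\|^c),$$ where $\mu_x$ is the derivative of $\mu$ in its first variable, vectors carry the Euclidean norm and matrices the induced operator norm. For an integer $m\ge 1$ put $h=1/m$ and $t_n=nh$,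 and define the tamed Euler iterates of the equation with piecewise continuous argument $dx(t)=\mu(x(t),x([t]))\,dt+\sigma(x(t),x([t]))\,dB(t)$, $x(0)=\xi$ ($[\cdot]$ being the greatest-integer function) by $y_0=\xi$ and $$y_{n+1}=y_n+\frac{h\,\mu(y_n,y_{[nh]m})}{1+h\|\mu(y_n,y_{[nh]m})\|}+\sigma(y_n,y_{[nh]m})\,\bigl(B(t_{n+1})-B(t_n)\bigr),\qquad n\ge 0$$ (the $y_n$ depend on $m$). Then for every real $T\ge 0$ and every $p\in[1,\infty)$ $$\sup_{m\ge 1}\ \sup_{0\le n\le Tm}\ \mathbb E\|y_n\|^p<\infty .$$ -/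

import Mathlib

open MeasureTheory ProbabilityTheory
open scoped NNReal ENNReal

noncomputable section

/-- `B` is an `r`-dimensional Brownian motion relative to the filtration `𝓕` under `P`:
it is adapted, its coordinates are independent real Brownian motions (as processes), and each
increment `B t - B s` with `s ≤ t` is independent of `𝓕 s`. -/
structure IsFilteredBrownianMotion {Ω : Type*} {mΩ : MeasurableSpace Ω} (P : Measure Ω)
    (𝓕 : Filtration ℝ≥0 mΩ) {r : ℕ} (B : ℝ≥0 → Ω → EuclideanSpace ℝ (Fin r)) : Prop where
  adapted : StronglyAdapted 𝓕 B
  brownian_coord : ∀ i : Fin r, IsBrownianReal (fun t ω => B t ω i) P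
  indep_coord : iIndepFun (fun (i : Fin r) (ω : Ω) (t : ℝ≥0) => B t ω i) P
  indep_increment : ∀ s t : ℝ≥0, s ≤ t →
    Indep (MeasurableSpace.comap (fun ω => B t ω - B s ω) inferInstance) (𝓕 s) P

/-- The standing assumptions on the coefficients of
`dx(t) = μ(x(t), x([t])) dt + σ(x(t), x([t])) dB(t)`.
A `d × r` matrix is represented by the linear map it induces; the norm is the operator norm for the
Euclidean norms. The partial derivative in the first variable is
`fderiv ℝ (fun z => μ (z, y)) x`, a genuine derivative since `μ` is `C¹`. -/
structure SEPCAAssumption {d r : ℕ}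
    (μ : EuclideanSpace ℝ (Fin d) × EuclideanSpace ℝ (Fin d) → EuclideanSpace ℝ (Fin d))
    (σ : EuclideanSpace ℝ (Fin d) × EuclideanSpace ℝ (Fin d) →
      (EuclideanSpace ℝ (Fin r) →L[ℝ] EuclideanSpace ℝ (Fin d)))
    (K c : ℝ) : Prop where
  K_nonneg : 0 ≤ K
  c_nonneg : 0 ≤ c
  contDiff_drift : ContDiff ℝ 1 μ
  diffusion_lipschitz : ∀ x₁ y₁ x₂ y₂,
    ‖σ (x₁, y₁) - σ (x₂, y₂)‖ ≤ K * (‖x₁ - x₂‖ + ‖y₁ - y₂‖)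
  drift_oneSided : ∀ x₁ x₂ y,
    inner ℝ (x₁ - x₂) (μ (x₁, y) - μ (x₂, y)) ≤ K * ‖x₁ - x₂‖ ^ 2
  drift_lipschitz_delay : ∀ x y₁ y₂, ‖μ (x, y₁) - μ (x, y₂)‖ ≤ K * ‖y₁ - y₂‖
  drift_deriv_growth : ∀ x y, ‖fderiv ℝ (fun z => μ (z, y)) x‖ ≤ K * (1 + ‖x‖ ^ c)

/-- The tamed Euler iterates `y_n` with step size `h = 1 / m`, started at `y_0 = ξ`:
`y_{n+1} = y_n + h μ(y_n, y_k) / (1 + h ‖μ(y_n, y_k)‖) + σ(y_n, y_k) (B(t_{n+1}) - B(t_n))`,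
where `t_n = n / m` and `k = [n h] m`. Here `[n h]` is the integer quotient `n / m` of natural
numbers, so that `k = (n / m) * m ≤ n`. -/
def tamedEuler {Ω : Type*} {d r : ℕ}
    (μ : EuclideanSpace ℝ (Fin d) × EuclideanSpace ℝ (Fin d) → EuclideanSpace ℝ (Fin d))
    (σ : EuclideanSpace ℝ (Fin d) × EuclideanSpace ℝ (Fin d) →
      (EuclideanSpace ℝ (Fin r) →L[ℝ] EuclideanSpace ℝ (Fin d)))
    (ξ : Ω → EuclideanSpace ℝ (Fin d)) (B : ℝ≥0 → Ω → EuclideanSpace ℝ (Fin r)) (m : ℕ) :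
    ℕ → Ω → EuclideanSpace ℝ (Fin d)
  | 0, ω => ξ ω
  | n + 1, ω =>
    let h : ℝ := 1 / (m : ℝ)
    let y := tamedEuler μ σ ξ B m n ω
    let z := tamedEuler μ σ ξ B m (n / m * m) ω
    y + (h / (1 + h * ‖μ (y, z)‖)) • μ (y, z)
      + σ (y, z) (B (((n + 1 : ℕ) : ℝ≥0) / (m : ℝ≥0)) ω - B ((n : ℝ≥0) / (m : ℝ≥0)) ω)
  termination_by n => n
  decreasing_by
    · exact Nat.lt_succ_self n
    · exact Nat.lt_succ_of_le (Nat.div_mul_le_self n m)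

theorem tamedEuler_zero {Ω : Type*} {d r : ℕ}
    (μ : EuclideanSpace ℝ (Fin d) × EuclideanSpace ℝ (Fin d) → EuclideanSpace ℝ (Fin d))
    (σ : EuclideanSpace ℝ (Fin d) × EuclideanSpace ℝ (Fin d) →
      (EuclideanSpace ℝ (Fin r) →L[ℝ] EuclideanSpace ℝ (Fin d)))
    (ξ : Ω → EuclideanSpace ℝ (Fin d)) (B : ℝ≥0 → Ω → EuclideanSpace ℝ (Fin r)) (m : ℕ) (ω : Ω) :
    tamedEuler μ σ ξ B m 0 ω = ξ ω := by
  rw [tamedEuler]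

theorem tamedEuler_succ {Ω : Type*} {d r : ℕ}
    (μ : EuclideanSpace ℝ (Fin d) × EuclideanSpace ℝ (Fin d) → EuclideanSpace ℝ (Fin d))
    (σ : EuclideanSpace ℝ (Fin d) × EuclideanSpace ℝ (Fin d) →
      (EuclideanSpace ℝ (Fin r) →L[ℝ] EuclideanSpace ℝ (Fin d)))
    (ξ : Ω → EuclideanSpace ℝ (Fin d)) (B : ℝ≥0 → Ω → EuclideanSpace ℝ (Fin r)) (m n : ℕ) (ω : Ω) :
    tamedEuler μ σ ξ B m (n + 1) ω =
      tamedEuler μ σ ξ B m n ω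
        + ((1 / (m : ℝ)) / (1 + (1 / (m : ℝ)) *
            ‖μ (tamedEuler μ σ ξ B m n ω, tamedEuler μ σ ξ B m (n / m * m) ω)‖)) •
            μ (tamedEuler μ σ ξ B m n ω, tamedEuler μ σ ξ B m (n / m * m) ω)
        + σ (tamedEuler μ σ ξ B m n ω, tamedEuler μ σ ξ B m (n / m * m) ω)
            (B (((n + 1 : ℕ) : ℝ≥0) / (m : ℝ≥0)) ω - B ((n : ℝ≥0) / (m : ℝ≥0)) ω) := by
  rw [tamedEuler]

end

/-!
# Uniform moment bounds for the tamed Euler scheme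

The tamed iterates are compared with the scheme stopped on leaving the ball of radius
`R = m ^ (1 / (2 (c + 1)))`.

Inside that ball the drift satisfies `h ‖μ‖² ≤ C (1 + ‖y‖² + ‖z‖²)` by its polynomial growth
(`SEPCAAssumption.mul_norm_drift_sq_le`), and `⟪y, μ⟫ ≤ C (1 + ‖y‖² + ‖z‖²)` by the one-sided
Lipschitz condition (`SEPCAAssumption.inner_drift_le`). A drift step therefore increases `‖y‖²` only
by `O(h)`, and as the Brownian increments are centred, independent of the past and of variance `h`,
a discrete Gronwall argument (`moment_step`, `moment_recursion`) bounds every moment of the stopped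
scheme uniformly in `m` (`exists_stopped_tamedEuler_bound`).

Without stopping, taming makes each drift increment at most `1` in norm. The same recursion with
the constant `1` replaced by `m²` then gives `𝔼 ‖yₙ‖ ^ p ≤ C m ^ p`
(`exists_tamedEuler_crude_bound`).

The two bounds combine as follows. If the scheme has left the ball up to time `n`, then the stopped
scheme `Yₙ` satisfies `‖Yₙ‖ > R` (`lt_norm_stoppedOutside`). As all moments of `Yₙ` are bounded
uniformly in `m` and `R` is a power of `m`, the probability of this event decays faster
than any power of `1 / m`, which compensates the polynomial growth of the crude bound.
-/

/-! ### Elementary inequalities -/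

/-- Second order expansion of `v ↦ ‖v‖ ^ (2 * (q + 1))` with an explicit bound on the remainder.
The term that is linear in `w` is kept exactly, because it is the one that averages out when `w` is
a centred noise. -/
theorem norm_add_pow_le {E : Type*} [NormedAddCommGroup E] [InnerProductSpace ℝ E]
    (v w : E) (q : ℕ) :
    ‖v + w‖ ^ (2 * (q + 1)) ≤ ‖v‖ ^ (2 * (q + 1)) + 2 * (q + 1) * (‖v‖ ^ (2 * q) * inner ℝ v w)
      + (q + 1) * (3 * q + 1) * (‖w‖ ^ 2 * (‖v‖ + ‖w‖) ^ (2 * q)) := by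
  induction q with
  | zero =>
    have := norm_add_sq_real v w
    simp only [zero_add, mul_one, mul_zero, pow_zero, Nat.cast_zero, one_mul]
    linarith
  | succ q ih =>
    have hsq := norm_add_sq_real v w
    have hx := real_inner_le_norm v w
    have hx' := abs_real_inner_le_norm v w
    have htri := norm_add_le v w
    have ha := norm_nonneg v
    have hb := norm_nonneg w
    set a := ‖v‖
    set b := ‖w‖
    set x := inner ℝ v w
    have hsq2 : ‖v + w‖ ^ 2 ≤ (a + b) ^ 2 := by gcongr
    have hx2 : x ^ 2 ≤ a ^ 2 * b ^ 2 := by rw [← mul_pow, ← sq_abs x]; gcongr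
    have e1 : a ^ (2 * q) ≤ (a + b) ^ (2 * q) := by gcongr; linarith
    have e0 : 0 ≤ a ^ (2 * q) := by positivity
    calc ‖v + w‖ ^ (2 * (q + 1 + 1)) = ‖v + w‖ ^ (2 * (q + 1)) * ‖v + w‖ ^ 2 := by ring
      _ ≤ (a ^ (2 * (q + 1)) + 2 * (q + 1) * (a ^ (2 * q) * x)
          + (q + 1) * (3 * q + 1) * (b ^ 2 * (a + b) ^ (2 * q))) * ‖v + w‖ ^ 2 := by gcongr
      _ = (a ^ (2 * q) * a ^ 2 + 2 * (q + 1) * (a ^ (2 * q) * x)) * (a ^ 2 + 2 * x + b ^ 2)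
          + (q + 1) * (3 * q + 1) * (b ^ 2 * (a + b) ^ (2 * q)) * ‖v + w‖ ^ 2 := by
        rw [← hsq]; ring
      _ ≤ (a ^ (2 * q) * a ^ 2 + 2 * (q + 1) * (a ^ (2 * q) * x)) * (a ^ 2 + 2 * x + b ^ 2)
          + (q + 1) * (3 * q + 1) * (b ^ 2 * (a + b) ^ (2 * q)) * (a + b) ^ 2 := by gcongr
      _ = a ^ (2 * (q + 1 + 1)) + 2 * (q + 1 + 1) * (a ^ (2 * (q + 1)) * x)
          + a ^ (2 * q) * (a ^ 2 * b ^ 2 + 4 * (q + 1) * x ^ 2 + 2 * (q + 1) * (x * b ^ 2))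
          + (q + 1) * (3 * q + 1) * (b ^ 2 * (a + b) ^ (2 * (q + 1))) := by ring
      _ ≤ a ^ (2 * (q + 1 + 1)) + 2 * (q + 1 + 1) * (a ^ (2 * (q + 1)) * x)
          + (a + b) ^ (2 * q) * ((6 * q + 7) * (b ^ 2 * (a + b) ^ 2))
          + (q + 1) * (3 * q + 1) * (b ^ 2 * (a + b) ^ (2 * (q + 1))) := by
        refine add_le_add (add_le_add le_rfl ?_) le_rfl
        have h3 : a ^ 2 * b ^ 2 + 4 * (q + 1) * x ^ 2 + 2 * (q + 1) * (x * b ^ 2)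
            ≤ a ^ 2 * b ^ 2 + 4 * (q + 1) * (a ^ 2 * b ^ 2) + 2 * (q + 1) * ((a * b) * b ^ 2) := by
          gcongr
        have h4 : a ^ 2 * b ^ 2 + 4 * (q + 1) * (a ^ 2 * b ^ 2) + 2 * (q + 1) * ((a * b) * b ^ 2)
            ≤ (6 * q + 7) * (b ^ 2 * (a + b) ^ 2) := by
          have : 0 ≤ (q * (2 * a ^ 2 + 10 * a * b + 6 * b ^ 2)
            + (2 * a ^ 2 + 12 * a * b + 7 * b ^ 2)) * b ^ 2 := by positivity
          linarith
        exact (mul_le_mul_of_nonneg_left (h3.trans h4) e0).trans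
          (mul_le_mul_of_nonneg_right e1 (by positivity))
      _ = _ := by push_cast; ring

theorem add_pow_le_add_mul_pow {s u h : ℝ} (hs : 0 ≤ s) (hu : 0 ≤ u) (h0 : 0 ≤ h) (h1 : h ≤ 1)
    (q : ℕ) : (s + h * u) ^ (q + 1) ≤ s ^ (q + 1) + h * ((q + 1) * (u * (s + u) ^ q)) := by
  induction q with
  | zero => simp
  | succ q ih =>
    have e1 : s ^ (q + 1) ≤ (s + u) ^ (q + 1) := by gcongr; linarith
    have e2 : s + h * u ≤ s + u := by nlinarith
    have e3 : 0 ≤ s + h * u := by positivity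
    calc (s + h * u) ^ (q + 1 + 1) = (s + h * u) ^ (q + 1) * (s + h * u) := by ring
      _ ≤ (s ^ (q + 1) + h * ((q + 1) * (u * (s + u) ^ q))) * (s + h * u) := by gcongr
      _ = s ^ (q + 1 + 1) + h * (u * s ^ (q + 1))
          + h * ((q + 1) * (u * (s + u) ^ q)) * (s + h * u) := by ring
      _ ≤ s ^ (q + 1 + 1) + h * (u * (s + u) ^ (q + 1))
          + h * ((q + 1) * (u * (s + u) ^ q)) * (s + u) := by gcongr
      _ = _ := by push_cast; ring

theorem add_add_pow_le {a b c : ℝ} (ha : 0 ≤ a) (hb : 0 ≤ b) (hc : 0 ≤ c) (q : ℕ) :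
    (a + b + c) ^ (q + 1) ≤ 4 ^ q * (a ^ (q + 1) + b ^ (q + 1) + c ^ (q + 1)) := by
  have h1 := add_pow_le (add_nonneg ha hb) hc (q + 1)
  have h2 := add_pow_le ha hb (q + 1)
  have h3 : (1 : ℝ) ≤ 2 ^ q := one_le_pow₀ (by norm_num)
  have h4 : 0 ≤ c ^ (q + 1) := by positivity
  simp only [Nat.add_sub_cancel] at h1 h2
  calc (a + b + c) ^ (q + 1) ≤ 2 ^ q * ((a + b) ^ (q + 1) + c ^ (q + 1)) := h1
    _ ≤ 2 ^ q * (2 ^ q * (a ^ (q + 1) + b ^ (q + 1)) + 2 ^ q * c ^ (q + 1)) := by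
      gcongr; nlinarith
    _ = _ := by rw [show (4 : ℝ) = 2 * 2 by norm_num, mul_pow]; ring

/-! ### Moments of a recursion driven by centred independent noise -/

/-- One step `Y ↦ V + S W` of a scheme, where `V` and `S` are known at the beginning of the step and
`W` is a centred noise independent of the past. If the drift part satisfies
`‖V‖² ≤ ‖Y‖² + h A L`, the noise coefficient satisfies `‖S‖² ≤ A L`, and the noise has moments of
order `h`, then the moment of order `2 (q + 1)` grows by at most a multiple of `h 𝔼 L ^ (q + 1)`. -/
theorem moment_step {Ω E F : Type*} {𝓖 mΩ : MeasurableSpace Ω} {P : Measure Ω}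
    [NormedAddCommGroup E] [InnerProductSpace ℝ E] [CompleteSpace E]
    [NormedAddCommGroup F] [InnerProductSpace ℝ F] [CompleteSpace F]
    [MeasurableSpace F] [BorelSpace F]
    (h𝓖 : 𝓖 ≤ mΩ) {Y V : Ω → E} {S : Ω → F →L[ℝ] E} {W : Ω → F}
    {L : Ω → ℝ} {h A M : ℝ} {q : ℕ}
    (hV : StronglyMeasurable[𝓖] V) (hS : StronglyMeasurable[𝓖] S) (hL : StronglyMeasurable[𝓖] L)
    (hY : AEStronglyMeasurable Y P)
    (hWind : Indep (MeasurableSpace.comap W inferInstance) 𝓖 P)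
    (h0 : 0 ≤ h) (h1 : h ≤ 1) (hA : 0 ≤ A)
    (hLint : Integrable (fun ω => L ω ^ (q + 1)) P)
    (hYL : ∀ ω, ‖Y ω‖ ^ 2 ≤ L ω)
    (hVL : ∀ ω, ‖V ω‖ ^ 2 ≤ ‖Y ω‖ ^ 2 + h * (A * L ω)) (hSL : ∀ ω, ‖S ω‖ ^ 2 ≤ A * L ω)
    (hWint : Integrable W P) (hW0 : ∫ ω, W ω ∂P = 0)
    (hWq : Integrable (fun ω => ‖W ω‖ ^ 2 * (1 + ‖W ω‖) ^ (2 * q)) P)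
    (hWM : ∫ ω, ‖W ω‖ ^ 2 * (1 + ‖W ω‖) ^ (2 * q) ∂P ≤ M * h) :
    Integrable (fun ω => ‖V ω + S ω (W ω)‖ ^ (2 * (q + 1))) P ∧
      ∫ ω, ‖V ω + S ω (W ω)‖ ^ (2 * (q + 1)) ∂P ≤ ∫ ω, ‖Y ω‖ ^ (2 * (q + 1)) ∂P
        + h * (A * (1 + A) ^ q * ((q + 1) + (q + 1) * (3 * q + 1) * M))
          * ∫ ω, L ω ^ (q + 1) ∂P := by
  have hL0 : ∀ ω, 0 ≤ L ω := fun ω => (sq_nonneg _).trans (hYL ω)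
  have hV2 : ∀ ω, ‖V ω‖ ^ 2 ≤ (1 + A) * L ω := fun ω => by
    have := mul_le_of_le_one_left (mul_nonneg hA (hL0 ω)) h1
    linarith [hVL ω, hYL ω]
  have hVm : AEStronglyMeasurable V P := (hV.mono h𝓖).aestronglyMeasurable
  have hSm : AEStronglyMeasurable S P := (hS.mono h𝓖).aestronglyMeasurable
  have hYint : Integrable (fun ω => ‖Y ω‖ ^ (2 * (q + 1))) P := by
    refine hLint.mono' (hY.norm.pow _) (ae_of_all _ fun ω => ?_)
    rw [Real.norm_of_nonneg (by positivity), pow_mul]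
    exact pow_le_pow_left₀ (by positivity) (hYL ω) _
  have hVle : ∀ ω, ‖V ω‖ ^ (2 * (q + 1)) ≤
      ‖Y ω‖ ^ (2 * (q + 1)) + h * ((q + 1) * (A * (1 + A) ^ q)) * L ω ^ (q + 1) := fun ω => by
    have hL0 := hL0 ω
    have hYL := hYL ω
    calc ‖V ω‖ ^ (2 * (q + 1)) = (‖V ω‖ ^ 2) ^ (q + 1) := pow_mul _ _ _
      _ ≤ (‖Y ω‖ ^ 2 + h * (A * L ω)) ^ (q + 1) := by gcongr; exact hVL ω
      _ ≤ (‖Y ω‖ ^ 2) ^ (q + 1) + h * ((q + 1) * (A * L ω * (‖Y ω‖ ^ 2 + A * L ω) ^ q)) :=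
        add_pow_le_add_mul_pow (by positivity) (by positivity) h0 h1 q
      _ ≤ (‖Y ω‖ ^ 2) ^ (q + 1) + h * ((q + 1) * (A * L ω * (L ω + A * L ω) ^ q)) := by gcongr
      _ = _ := by rw [show L ω + A * L ω = (1 + A) * L ω by ring, mul_pow, ← pow_mul]; ring
  -- The first order term is `⟪X, W⟫` with `X = ‖V‖ ^ (2 q) • S† V` known at the beginning of the
  -- step, so independence and `𝔼 W = 0` make its expectation vanish.
  set X : Ω → F := fun ω => (‖V ω‖ ^ (2 * q)) • (ContinuousLinearMap.adjoint (S ω)) (V ω) with hX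
  have hXm : StronglyMeasurable[𝓖] X := by
    have hadj : StronglyMeasurable[𝓖] fun ω => ContinuousLinearMap.adjoint (S ω) :=
      (ContinuousLinearMap.adjoint (𝕜 := ℝ) (E := F) (F := E)).continuous.comp_stronglyMeasurable hS
    have happ : StronglyMeasurable[𝓖] fun ω => (ContinuousLinearMap.adjoint (S ω)) (V ω) :=
      Continuous.comp_stronglyMeasurable (g := fun p : (E →L[ℝ] F) × E => p.1 p.2)
        (by fun_prop) (hadj.prodMk hV)
    exact (hV.norm.pow _).smul happ
  have hXint : Integrable X P := by
    refine (hLint.const_mul ((1 + A) ^ (q + 1))).mono' (hXm.mono h𝓖).aestronglyMeasurable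
      (ae_of_all _ fun ω => ?_)
    have hL0 := hL0 ω
    have hSV : ‖S ω‖ * ‖V ω‖ ≤ (1 + A) * L ω := by
      nlinarith [sq_nonneg (‖S ω‖ - ‖V ω‖), hSL ω, hV2 ω]
    calc ‖X ω‖ ≤ ‖V ω‖ ^ (2 * q) * (‖S ω‖ * ‖V ω‖) := by
          rw [hX, norm_smul, norm_pow, norm_norm]
          gcongr
          exact (ContinuousLinearMap.le_opNorm _ _).trans_eq (by rw [LinearIsometryEquiv.norm_map])
      _ ≤ ((1 + A) * L ω) ^ q * ((1 + A) * L ω) := by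
          rw [pow_mul]; gcongr; exact hV2 ω
      _ = _ := by rw [← pow_succ, mul_pow]
  have hXW : IndepFun X W P := by
    rw [IndepFun_iff_Indep]
    exact (indep_of_indep_of_le_right hWind hXm.measurable.comap_le).symm
  have hcross : ∀ ω, innerSL ℝ (X ω) (W ω) = ‖V ω‖ ^ (2 * q) * inner ℝ (V ω) (S ω (W ω)) := by
    intro ω
    simp only [hX, innerSL_apply_apply, inner_smul_left, ContinuousLinearMap.adjoint_inner_left]
    simp
  have hcint : Integrable (fun ω => ‖V ω‖ ^ (2 * q) * inner ℝ (V ω) (S ω (W ω))) P := by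
    simp_rw [← hcross]; exact hXW.integrable_bilin hXint hWint (innerSL ℝ)
  have hc0 : ∫ ω, ‖V ω‖ ^ (2 * q) * inner ℝ (V ω) (S ω (W ω)) ∂P = 0 := by
    simp_rw [← hcross]
    rw [hXW.integral_bilin hXint hWint (innerSL ℝ), hW0, map_zero]
  -- The remainder is at most `L ^ (q + 1)` times a function of `W`, and its expectation factors.
  have hLW : IndepFun (fun ω => L ω ^ (q + 1)) (fun ω => ‖W ω‖ ^ 2 * (1 + ‖W ω‖) ^ (2 * q)) P := by
    have h : IndepFun L W P := by
      rw [IndepFun_iff_Indep]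
      exact (indep_of_indep_of_le_right hWind hL.measurable.comap_le).symm
    exact h.comp (φ := fun x : ℝ => x ^ (q + 1))
      (ψ := fun w : F => ‖w‖ ^ 2 * (1 + ‖w‖) ^ (2 * q)) (by fun_prop) (by fun_prop)
  have hrem : ∀ ω, ‖S ω (W ω)‖ ^ 2 * (‖V ω‖ + ‖S ω (W ω)‖) ^ (2 * q) ≤
      A * (1 + A) ^ q * (L ω ^ (q + 1) * (‖W ω‖ ^ 2 * (1 + ‖W ω‖) ^ (2 * q))) := fun ω => by
    have hL0 := hL0 ω
    have hN : ‖S ω (W ω)‖ ≤ ‖S ω‖ * ‖W ω‖ := ContinuousLinearMap.le_opNorm _ _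
    have hN2 : ‖S ω (W ω)‖ ^ 2 ≤ A * L ω * ‖W ω‖ ^ 2 := by
      calc ‖S ω (W ω)‖ ^ 2 ≤ (‖S ω‖ * ‖W ω‖) ^ 2 := by gcongr
        _ = ‖S ω‖ ^ 2 * ‖W ω‖ ^ 2 := mul_pow _ _ _
        _ ≤ _ := by gcongr; exact hSL ω
    have hsV : ‖V ω‖ ≤ √((1 + A) * L ω) := Real.le_sqrt_of_sq_le (hV2 ω)
    have hsS : ‖S ω‖ ≤ √((1 + A) * L ω) :=
      Real.le_sqrt_of_sq_le ((hSL ω).trans (by gcongr; linarith))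
    have hsum : (‖V ω‖ + ‖S ω (W ω)‖) ^ 2 ≤ (1 + A) * L ω * (1 + ‖W ω‖) ^ 2 := by
      calc (‖V ω‖ + ‖S ω (W ω)‖) ^ 2
          ≤ (√((1 + A) * L ω) + √((1 + A) * L ω) * ‖W ω‖) ^ 2 := by
            gcongr; exact hN.trans (by gcongr)
        _ = √((1 + A) * L ω) ^ 2 * (1 + ‖W ω‖) ^ 2 := by ring
        _ = _ := by rw [Real.sq_sqrt (by positivity)]
    calc ‖S ω (W ω)‖ ^ 2 * (‖V ω‖ + ‖S ω (W ω)‖) ^ (2 * q)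
        ≤ A * L ω * ‖W ω‖ ^ 2 * ((1 + A) * L ω * (1 + ‖W ω‖) ^ 2) ^ q := by
          rw [pow_mul]; gcongr
      _ = _ := by rw [mul_pow, mul_pow, ← pow_mul]; ring
  have hRint := (hLW.integrable_mul hLint hWq).const_mul (A * (1 + A) ^ q)
  have hRle : ∫ ω, A * (1 + A) ^ q * (L ω ^ (q + 1) * (‖W ω‖ ^ 2 * (1 + ‖W ω‖) ^ (2 * q))) ∂P ≤
      A * (1 + A) ^ q * ((∫ ω, L ω ^ (q + 1) ∂P) * (M * h)) := by
    rw [integral_const_mul, hLW.integral_fun_mul_eq_mul_integral hLint.aestronglyMeasurable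
      hWq.aestronglyMeasurable]
    have : 0 ≤ ∫ ω, L ω ^ (q + 1) ∂P := integral_nonneg fun ω => pow_nonneg (hL0 ω) _
    gcongr
  have hpt : ∀ ω, ‖V ω + S ω (W ω)‖ ^ (2 * (q + 1)) ≤ ‖Y ω‖ ^ (2 * (q + 1))
      + h * ((q + 1) * (A * (1 + A) ^ q)) * L ω ^ (q + 1)
      + 2 * (q + 1) * (‖V ω‖ ^ (2 * q) * inner ℝ (V ω) (S ω (W ω)))
      + (q + 1) * (3 * q + 1) * (A * (1 + A) ^ q *
        (L ω ^ (q + 1) * (‖W ω‖ ^ 2 * (1 + ‖W ω‖) ^ (2 * q)))) := fun ω => by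
    refine (norm_add_pow_le (V ω) (S ω (W ω)) q).trans ?_
    exact add_le_add (add_le_add (hVle ω) le_rfl)
      (mul_le_mul_of_nonneg_left (hrem ω) (by positivity))
  have hi1 := hLint.const_mul (h * ((q + 1) * (A * (1 + A) ^ q)))
  have hi2 := hcint.const_mul (2 * ((q : ℝ) + 1))
  have hi3 := hRint.const_mul (((q : ℝ) + 1) * (3 * q + 1))
  have hi12 : Integrable (fun ω => ‖Y ω‖ ^ (2 * (q + 1))
      + h * ((q + 1) * (A * (1 + A) ^ q)) * L ω ^ (q + 1)) P := hYint.add hi1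
  have hi123 : Integrable (fun ω => ‖Y ω‖ ^ (2 * (q + 1))
      + h * ((q + 1) * (A * (1 + A) ^ q)) * L ω ^ (q + 1)
      + 2 * (q + 1) * (‖V ω‖ ^ (2 * q) * inner ℝ (V ω) (S ω (W ω)))) P := hi12.add hi2
  have hint := hi123.add hi3
  have hSW : AEStronglyMeasurable (fun ω => S ω (W ω)) P :=
    Continuous.comp_aestronglyMeasurable (g := fun p : (F →L[ℝ] E) × F => p.1 p.2)
        (by fun_prop) (hSm.prodMk hWint.aestronglyMeasurable)
  have hfin : Integrable (fun ω => ‖V ω + S ω (W ω)‖ ^ (2 * (q + 1))) P := by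
    refine hint.mono' ((hVm.add hSW).norm.pow _) (ae_of_all _ fun ω => ?_)
    rw [Real.norm_of_nonneg (by positivity)]
    exact hpt ω
  refine ⟨hfin, (integral_mono hfin hint hpt).trans ?_⟩
  refine (integral_add hi123 hi3).trans_le ?_
  rw [integral_add hi12 hi2, integral_add hYint hi1, integral_const_mul, integral_const_mul, hc0,
    mul_zero, add_zero, integral_const_mul]
  have := mul_le_mul_of_nonneg_left hRle (show (0 : ℝ) ≤ (q + 1) * (3 * q + 1) by positivity)
  simp only [Pi.mul_apply]
  linarith

/-- Discrete Gronwall estimate for a scheme whose steps satisfy the hypotheses of `moment_step` with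
`L = ρ² + ‖Y n‖² + ‖Y (κ n)‖²`, where `κ n ≤ n` is the index of a delayed value. The constant `ρ`
enters homogeneously, so that it may be taken large. -/
theorem moment_recursion {Ω E F : Type*} {mΩ : MeasurableSpace Ω} {P : Measure Ω}
    [IsProbabilityMeasure P]
    [NormedAddCommGroup E] [InnerProductSpace ℝ E] [CompleteSpace E]
    [NormedAddCommGroup F] [InnerProductSpace ℝ F] [CompleteSpace F]
    [MeasurableSpace F] [BorelSpace F]
    {𝓖 : ℕ → MeasurableSpace Ω} (h𝓖 : ∀ n, 𝓖 n ≤ mΩ) (h𝓖mono : Monotone 𝓖)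
    {Y V : ℕ → Ω → E} {S : ℕ → Ω → F →L[ℝ] E} {W : ℕ → Ω → F} {κ : ℕ → ℕ}
    {ρ h A M : ℝ} {q : ℕ}
    (hY : ∀ n, StronglyMeasurable[𝓖 n] (Y n)) (hV : ∀ n, StronglyMeasurable[𝓖 n] (V n))
    (hS : ∀ n, StronglyMeasurable[𝓖 n] (S n)) (hκ : ∀ n, κ n ≤ n)
    (hYsucc : ∀ n ω, Y (n + 1) ω = V n ω + S n ω (W n ω))
    (hWind : ∀ n, Indep (MeasurableSpace.comap (W n) inferInstance) (𝓖 n) P)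
    (h0 : 0 ≤ h) (h1 : h ≤ 1) (hA : 0 ≤ A) (hM : 0 ≤ M)
    (hVL : ∀ n ω, ‖V n ω‖ ^ 2 ≤
      ‖Y n ω‖ ^ 2 + h * (A * (ρ ^ 2 + ‖Y n ω‖ ^ 2 + ‖Y (κ n) ω‖ ^ 2)))
    (hSL : ∀ n ω, ‖S n ω‖ ^ 2 ≤ A * (ρ ^ 2 + ‖Y n ω‖ ^ 2 + ‖Y (κ n) ω‖ ^ 2))
    (hWint : ∀ n, Integrable (W n) P) (hW0 : ∀ n, ∫ ω, W n ω ∂P = 0)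
    (hWq : ∀ n, Integrable (fun ω => ‖W n ω‖ ^ 2 * (1 + ‖W n ω‖) ^ (2 * q)) P)
    (hWM : ∀ n, ∫ ω, ‖W n ω‖ ^ 2 * (1 + ‖W n ω‖) ^ (2 * q) ∂P ≤ M * h)
    (hY0 : Integrable (fun ω => ‖Y 0 ω‖ ^ (2 * (q + 1))) P) (n : ℕ) :
    Integrable (fun ω => ‖Y n ω‖ ^ (2 * (q + 1))) P ∧
      ρ ^ (2 * (q + 1)) + ∫ ω, ‖Y n ω‖ ^ (2 * (q + 1)) ∂P ≤
        (1 + h * (2 * 4 ^ q * (A * (1 + A) ^ q * ((q + 1) + (q + 1) * (3 * q + 1) * M)))) ^ n *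
          (ρ ^ (2 * (q + 1)) + ∫ ω, ‖Y 0 ω‖ ^ (2 * (q + 1)) ∂P) := by
  set C : ℝ := A * (1 + A) ^ q * ((q + 1) + (q + 1) * (3 * q + 1) * M) with hC
  have hC0 : 0 ≤ C := by positivity
  set u : ℕ → ℝ := fun n => ρ ^ (2 * (q + 1)) + ∫ ω, ‖Y n ω‖ ^ (2 * (q + 1)) ∂P with hu
  have hρ : 0 ≤ ρ ^ (2 * (q + 1)) := by rw [pow_mul]; positivity
  have hu0 : ∀ n, 0 ≤ u n := fun n => add_nonneg hρ (integral_nonneg fun ω => by positivity)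
  set β : ℝ := 1 + h * (2 * 4 ^ q * C) with hβ
  have hβ1 : 1 ≤ β := by rw [hβ]; linarith [show 0 ≤ h * (2 * 4 ^ q * C) by positivity]
  change _ ∧ u n ≤ β ^ n * u 0
  induction n using Nat.strong_induction_on with
  | _ n ih =>
    rcases n with _ | n
    · exact ⟨hY0, by simp⟩
    -- The bound is monotone in the index, so the delayed value obeys the bound for `Y n`.
    obtain ⟨hi1, hb1⟩ := ih n n.lt_succ_self
    obtain ⟨hi2, hb2⟩ := ih (κ n) (Nat.lt_succ_of_le (hκ n))
    have hb2' : u (κ n) ≤ β ^ n * u 0 :=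
      hb2.trans (mul_le_mul_of_nonneg_right (pow_le_pow_right₀ hβ1 (hκ n)) (hu0 0))
    have hYκ : StronglyMeasurable[𝓖 n] (Y (κ n)) := (hY (κ n)).mono (h𝓖mono (hκ n))
    have hLm : StronglyMeasurable[𝓖 n] fun ω => ρ ^ 2 + ‖Y n ω‖ ^ 2 + ‖Y (κ n) ω‖ ^ 2 :=
      (stronglyMeasurable_const.add ((hY n).norm.pow 2)).add (hYκ.norm.pow 2)
    have hle : ∀ ω, (ρ ^ 2 + ‖Y n ω‖ ^ 2 + ‖Y (κ n) ω‖ ^ 2) ^ (q + 1) ≤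
        4 ^ q * (ρ ^ (2 * (q + 1)) + ‖Y n ω‖ ^ (2 * (q + 1)) + ‖Y (κ n) ω‖ ^ (2 * (q + 1))) := by
      intro ω
      simp only [pow_mul]
      exact add_add_pow_le (by positivity) (by positivity) (by positivity) q
    have hi0 := integrable_const (μ := P) (ρ ^ (2 * (q + 1)))
    have hi01 : Integrable (fun ω => ρ ^ (2 * (q + 1)) + ‖Y n ω‖ ^ (2 * (q + 1))) P := hi0.add hi1
    have hdom := (hi01.add hi2).const_mul (4 ^ q)
    have hLint : Integrable (fun ω => (ρ ^ 2 + ‖Y n ω‖ ^ 2 + ‖Y (κ n) ω‖ ^ 2) ^ (q + 1)) P := by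
      refine hdom.mono' ((hLm.pow _).mono (h𝓖 n)).aestronglyMeasurable (ae_of_all _ fun ω => ?_)
      rw [Real.norm_of_nonneg (by positivity)]
      exact hle ω
    have hLb : ∫ ω, (ρ ^ 2 + ‖Y n ω‖ ^ 2 + ‖Y (κ n) ω‖ ^ 2) ^ (q + 1) ∂P ≤
        4 ^ q * (u n + u (κ n)) := by
      refine (integral_mono hLint hdom hle).trans ?_
      rw [integral_const_mul]
      gcongr
      refine (integral_add hi01 hi2).trans_le ?_
      rw [integral_add hi0 hi1]
      simp only [hu, integral_const, probReal_univ, one_smul]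
      linarith
    obtain ⟨hint, hbd⟩ := moment_step (h𝓖 n) (hV n) (hS n) hLm
      ((hY n).mono (h𝓖 n)).aestronglyMeasurable (hWind n) h0 h1 hA hLint
      (fun ω => by linarith [sq_nonneg ρ, sq_nonneg ‖Y (κ n) ω‖]) (hVL n) (hSL n)
      (hWint n) (hW0 n) (hWq n) (hWM n)
    simp_rw [← hYsucc] at hint hbd
    refine ⟨hint, ?_⟩
    calc u (n + 1) ≤ u n + h * C * (4 ^ q * (u n + u (κ n))) := by
          have := mul_le_mul_of_nonneg_left hLb (mul_nonneg h0 hC0)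
          simp only [hu] at this ⊢
          linarith
      _ ≤ β ^ n * u 0 + h * C * (4 ^ q * (β ^ n * u 0 + β ^ n * u 0)) := by gcongr
      _ = β ^ (n + 1) * u 0 := by rw [hβ]; ring

theorem one_add_mul_pow_le_exp {h C T : ℝ} (h0 : 0 ≤ h) (hC : 0 ≤ C) {n : ℕ} (hn : n * h ≤ T) :
    (1 + h * C) ^ n ≤ Real.exp (C * T) := by
  calc (1 + h * C) ^ n ≤ Real.exp (h * C) ^ n := by
        gcongr; rw [add_comm]; exact Real.add_one_le_exp _
    _ = Real.exp (n * (h * C)) := (Real.exp_nat_mul _ _).symm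
    _ ≤ _ := by
      refine Real.exp_le_exp.2 ?_
      calc n * (h * C) = C * (n * h) := by ring
        _ ≤ C * T := by gcongr

/-! ### Moments of Brownian increments -/

/-- The noise moment of `moment_step` in terms of the coordinates of `w / t`. With `t ^ 2` the
variance of a coordinate, these are standard Gaussian, and the bound is of order `t ^ 2`. -/
theorem norm_sq_mul_one_add_norm_pow_le {r : ℕ} (w : EuclideanSpace ℝ (Fin r)) {t : ℝ}
    (t0 : 0 < t) (t1 : t ≤ 1) (q : ℕ) :
    ‖w‖ ^ 2 * (1 + ‖w‖) ^ (2 * q) ≤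
      t ^ 2 * (2 ^ (2 * q + 1) * (1 + r ^ q * ∑ i, (t⁻¹ * w i) ^ (2 * (q + 1)))) := by
  set D : ℝ := t⁻¹ * ‖w‖ with hD
  have hD0 : 0 ≤ D := by positivity
  have hw : ‖w‖ = t * D := by rw [hD]; field_simp
  have hsq : D ^ 2 = ∑ i, (t⁻¹ * w i) ^ 2 := by
    rw [hD, mul_pow, EuclideanSpace.real_norm_sq_eq, Finset.mul_sum]
    simp_rw [mul_pow]
  have hsum : (∑ i, (t⁻¹ * w i) ^ 2) ^ (q + 1) ≤ r ^ q * ∑ i, (t⁻¹ * w i) ^ (2 * (q + 1)) := by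
    simp_rw [pow_mul]
    simpa using pow_sum_le_card_mul_sum_pow (s := Finset.univ)
      (f := fun i => (t⁻¹ * w i) ^ 2) (fun i _ => sq_nonneg _) q
  have htD : t * D ≤ D := mul_le_of_le_one_left hD0 t1
  calc ‖w‖ ^ 2 * (1 + ‖w‖) ^ (2 * q) = t ^ 2 * (D ^ 2 * (1 + t * D) ^ (2 * q)) := by rw [hw]; ring
    _ ≤ t ^ 2 * ((1 + D) ^ 2 * (1 + D) ^ (2 * q)) := by gcongr; linarith
    _ = t ^ 2 * (1 + D) ^ (2 * (q + 1)) := by ring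
    _ ≤ t ^ 2 * (2 ^ (2 * q + 1) * (1 + D ^ (2 * (q + 1)))) := by
      gcongr
      simpa [show 2 * (q + 1) - 1 = 2 * q + 1 by omega] using
        add_pow_le zero_le_one hD0 (2 * (q + 1))
    _ ≤ _ := by
      rw [pow_mul D, hsq]; gcongr

theorem integrable_comp_of_hasLaw {Ω α : Type*} {mΩ : MeasurableSpace Ω} {mα : MeasurableSpace α}
    {P : Measure Ω} {ν : Measure α} {X : Ω → α} (hX : HasLaw X ν P) {f : α → ℝ}
    (hf : Integrable f ν) : Integrable (fun ω => f (X ω)) P := by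
  rw [← hX.map_eq] at hf
  exact hf.comp_aemeasurable hX.aemeasurable

namespace IsFilteredBrownianMotion

variable {Ω : Type*} {mΩ : MeasurableSpace Ω} {P : Measure Ω}
  {𝓕 : Filtration ℝ≥0 mΩ} {r : ℕ} {B : ℝ≥0 → Ω → EuclideanSpace ℝ (Fin r)}

theorem hasLaw_increment_coord (hB : IsFilteredBrownianMotion P 𝓕 B) (s h : ℝ≥0) (i : Fin r) :
    HasLaw (fun ω => (B (s + h) ω - B s ω) i) (gaussianReal 0 h) P := by
  have := (hB.brownian_coord i).toIsPreBrownianReal.hasLaw_sub (s + h) s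
  have e : nndist (s + h).1 s.1 = h := by
    ext; simp [NNReal.coe_add]
  rw [e] at this
  exact this

theorem hasLaw_scaled_increment_coord (hB : IsFilteredBrownianMotion P 𝓕 B) (s : ℝ≥0) {h : ℝ≥0}
    (hh : 0 < h) (i : Fin r) :
    HasLaw (fun ω => (√(h : ℝ))⁻¹ * (B (s + h) ω - B s ω) i) (gaussianReal 0 1) P := by
  have h1 := gaussianReal_const_mul (hB.hasLaw_increment_coord s h i) (√(h : ℝ))⁻¹
  have e : NNReal.mk ((√(h : ℝ))⁻¹ ^ 2) (sq_nonneg _) * h = 1 := by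
    ext
    simp [hh.ne']
  simpa only [mul_zero, e] using h1

theorem integrable_increment (hB : IsFilteredBrownianMotion P 𝓕 B) (s h : ℝ≥0) :
    Integrable (fun ω => B (s + h) ω - B s ω) P := by
  refine Integrable.of_eval_piLp fun i => ?_
  have hl := hB.hasLaw_increment_coord s h i
  exact integrable_comp_of_hasLaw hl (f := fun x : ℝ => x)
    ((memLp_id_gaussianReal 1).integrable le_rfl)

theorem integral_increment (hB : IsFilteredBrownianMotion P 𝓕 B) (s h : ℝ≥0) :
    ∫ ω, (B (s + h) ω - B s ω) ∂P = 0 := by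
  ext i
  rw [eval_integral_piLp]
  · rw [(hB.hasLaw_increment_coord s h i).integral_eq, integral_id_gaussianReal]
    rfl
  · exact fun i => (hB.integrable_increment s h).eval_piLp i

theorem integrable_and_integral_increment_le [IsProbabilityMeasure P]
    (hB : IsFilteredBrownianMotion P 𝓕 B) (s : ℝ≥0) {h : ℝ≥0}
    (hh : 0 < h) (h1 : h ≤ 1) (q : ℕ) :
    Integrable (fun ω => ‖B (s + h) ω - B s ω‖ ^ 2 * (1 + ‖B (s + h) ω - B s ω‖) ^ (2 * q)) P ∧
      ∫ ω, ‖B (s + h) ω - B s ω‖ ^ 2 * (1 + ‖B (s + h) ω - B s ω‖) ^ (2 * q) ∂P ≤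
        (2 ^ (2 * q + 1) * (1 + r ^ q * (r * ∫ x, x ^ (2 * (q + 1)) ∂(gaussianReal 0 1)))) * h := by
  have ht : 0 < √(h : ℝ) := by positivity
  have ht1 : √(h : ℝ) ≤ 1 := Real.sqrt_le_one.2 (by exact_mod_cast h1)
  have hpow : Integrable (fun x : ℝ => x ^ (2 * (q + 1))) (gaussianReal 0 1) := by
    have := (memLp_id_gaussianReal (μ := 0) (v := 1) (2 * (q + 1) : ℕ)).integrable_norm_pow
      (by positivity)
    refine this.congr (ae_of_all _ fun x => ?_)
    simp [pow_mul]
  have hi : ∀ i, Integrable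
      (fun ω => ((√(h : ℝ))⁻¹ * (B (s + h) ω - B s ω) i) ^ (2 * (q + 1))) P := fun i =>
    integrable_comp_of_hasLaw (hB.hasLaw_scaled_increment_coord s hh i) hpow
  have hi' := ((integrable_const (μ := P) (1 : ℝ)).add ((integrable_finsetSum Finset.univ
    fun i _ => hi i).const_mul ((r : ℝ) ^ q))).const_mul (2 ^ (2 * q + 1))
  have hdom := hi'.const_mul (√(h : ℝ) ^ 2)
  have hle := fun ω => norm_sq_mul_one_add_norm_pow_le (B (s + h) ω - B s ω) ht ht1 q
  have hint : Integrable (fun ω => ‖B (s + h) ω - B s ω‖ ^ 2 *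
      (1 + ‖B (s + h) ω - B s ω‖) ^ (2 * q)) P := by
    have hm := (hB.integrable_increment s h).aestronglyMeasurable
    refine hdom.mono' ((hm.norm.pow 2).mul ((aestronglyMeasurable_const.add hm.norm).pow _))
      (ae_of_all _ fun ω => ?_)
    rw [Real.norm_of_nonneg (by positivity)]
    exact hle ω
  refine ⟨hint, (integral_mono hint hdom hle).trans_eq ?_⟩
  have e : ∀ i, ∫ ω, ((√(h : ℝ))⁻¹ * (B (s + h) ω - B s ω) i) ^ (2 * (q + 1)) ∂P =
      ∫ x, x ^ (2 * (q + 1)) ∂(gaussianReal 0 1) := fun i =>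
    (hB.hasLaw_scaled_increment_coord s hh i).integral_comp
      (f := fun x : ℝ => x ^ (2 * (q + 1))) (by fun_prop)
  rw [integral_const_mul, integral_const_mul]
  have e2 := integral_add (integrable_const (μ := P) (1 : ℝ)) ((integrable_finsetSum Finset.univ
    fun i _ => hi i).const_mul ((r : ℝ) ^ q))
  rw [integral_const_mul, integral_finsetSum _ fun i _ => hi i] at e2
  simp only [e, integral_const, probReal_univ, one_smul, Finset.sum_const, Finset.card_univ,
    Fintype.card_fin, nsmul_eq_mul] at e2
  refine (congrArg (fun z => √(h : ℝ) ^ 2 * (2 ^ (2 * q + 1) * z)) e2).trans ?_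
  simp only [Real.sq_sqrt (NNReal.coe_nonneg h)]
  ring

end IsFilteredBrownianMotion

/-! ### Growth of the coefficients -/

namespace SEPCAAssumption

variable {d r : ℕ}
    {μ : EuclideanSpace ℝ (Fin d) × EuclideanSpace ℝ (Fin d) → EuclideanSpace ℝ (Fin d)}
    {σ : EuclideanSpace ℝ (Fin d) × EuclideanSpace ℝ (Fin d) →
      (EuclideanSpace ℝ (Fin r) →L[ℝ] EuclideanSpace ℝ (Fin d))} {K c : ℝ}

theorem continuous_diffusion (hμσ : SEPCAAssumption μ σ K c) : Continuous σ := by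
  refine (LipschitzWith.of_dist_le_mul (K := (2 * K).toNNReal) fun p p' => ?_).continuous
  have hK := hμσ.K_nonneg
  rw [dist_eq_norm, dist_eq_norm, Real.coe_toNNReal _ (by positivity)]
  calc ‖σ p - σ p'‖ ≤ K * (‖p.1 - p'.1‖ + ‖p.2 - p'.2‖) := hμσ.diffusion_lipschitz _ _ _ _
    _ ≤ K * (‖p - p'‖ + ‖p - p'‖) := by
      gcongr
      · exact norm_fst_le (p - p')
      · exact norm_snd_le (p - p')
    _ = _ := by ring

theorem norm_diffusion_sq_le (hμσ : SEPCAAssumption μ σ K c) {ρ : ℝ} (hρ : 1 ≤ ρ)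
    (x z : EuclideanSpace ℝ (Fin d)) :
    ‖σ (x, z)‖ ^ 2 ≤ 3 * (‖σ (0, 0)‖ ^ 2 + K ^ 2) * (ρ ^ 2 + ‖x‖ ^ 2 + ‖z‖ ^ 2) := by
  have hK := hμσ.K_nonneg
  have h1 : ‖σ (x, z)‖ ≤ ‖σ (0, 0)‖ + K * ‖x‖ + K * ‖z‖ := by
    have := hμσ.diffusion_lipschitz x z 0 0
    have h2 := norm_sub_norm_le (σ (x, z)) (σ (0, 0))
    simp only [sub_zero] at this
    linarith
  have hρ2 : 1 ≤ ρ ^ 2 := one_le_pow₀ hρ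
  set s := ‖σ (0, 0)‖
  calc ‖σ (x, z)‖ ^ 2 ≤ (s + K * ‖x‖ + K * ‖z‖) ^ 2 := by gcongr
    _ ≤ 3 * (s ^ 2 * 1 + K ^ 2 * ‖x‖ ^ 2 + K ^ 2 * ‖z‖ ^ 2) := by
      linarith [sq_nonneg (s - K * ‖x‖), sq_nonneg (s - K * ‖z‖), sq_nonneg (K * ‖x‖ - K * ‖z‖)]
    _ ≤ 3 * ((s ^ 2 + K ^ 2) * ρ ^ 2 + (s ^ 2 + K ^ 2) * ‖x‖ ^ 2 + (s ^ 2 + K ^ 2) * ‖z‖ ^ 2) := by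
      gcongr <;> nlinarith
    _ = _ := by ring

theorem norm_drift_zero_le (hμσ : SEPCAAssumption μ σ K c) (z : EuclideanSpace ℝ (Fin d)) :
    ‖μ (0, z)‖ ≤ ‖μ (0, 0)‖ + K * ‖z‖ := by
  have := hμσ.drift_lipschitz_delay 0 z 0
  have h2 := norm_sub_norm_le (μ (0, z)) (μ (0, 0))
  rw [sub_zero] at this
  linarith

theorem inner_drift_le (hμσ : SEPCAAssumption μ σ K c) (x z : EuclideanSpace ℝ (Fin d)) :
    inner ℝ x (μ (x, z)) ≤ (2 * K + ‖μ (0, 0)‖) * (1 + ‖x‖ ^ 2 + ‖z‖ ^ 2) := by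
  have hK := hμσ.K_nonneg
  have h1 := hμσ.drift_oneSided x 0 z
  have h2 := hμσ.norm_drift_zero_le z
  have h3 := real_inner_le_norm x (μ (0, z))
  have h4 : ‖x‖ * ‖μ (0, z)‖ ≤ ‖x‖ * (‖μ (0, 0)‖ + K * ‖z‖) := by gcongr
  rw [sub_zero, inner_sub_right] at h1
  have h5 : K * (‖x‖ * ‖z‖) ≤ K * (‖x‖ ^ 2 + ‖z‖ ^ 2) := by
    gcongr; nlinarith [sq_nonneg (‖x‖ - ‖z‖), sq_nonneg ‖x‖, sq_nonneg ‖z‖]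
  have h6 : ‖μ (0, 0)‖ * ‖x‖ ≤ ‖μ (0, 0)‖ * (1 + ‖x‖ ^ 2 + ‖z‖ ^ 2) := by
    gcongr; nlinarith [sq_nonneg (‖x‖ - 1), sq_nonneg ‖x‖, sq_nonneg ‖z‖]
  nlinarith [sq_nonneg ‖z‖]

theorem norm_drift_le (hμσ : SEPCAAssumption μ σ K c) (x z : EuclideanSpace ℝ (Fin d)) :
    ‖μ (x, z)‖ ≤ ‖μ (0, 0)‖ + K * ‖z‖ + K * (1 + ‖x‖ ^ c) * ‖x‖ := by
  have hK := hμσ.K_nonneg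
  have hdiff : Differentiable ℝ fun y => μ (y, z) :=
    (hμσ.contDiff_drift.differentiable one_ne_zero).comp (by fun_prop)
  have hconv := convex_closedBall (0 : EuclideanSpace ℝ (Fin d)) ‖x‖
  have h1 := hconv.norm_image_sub_le_of_norm_fderiv_le (𝕜 := ℝ) (f := fun y => μ (y, z))
    (C := K * (1 + ‖x‖ ^ c)) (x := 0) (y := x)
    (fun y _ => hdiff y) (fun y hy => by
      rw [mem_closedBall_zero_iff] at hy
      refine (hμσ.drift_deriv_growth y z).trans ?_
      have := hμσ.c_nonneg
      gcongr) (by simp) (by simp)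
  have h2 := hμσ.norm_drift_zero_le z
  have h3 := norm_sub_norm_le (μ (x, z)) (μ (0, z))
  rw [sub_zero] at h1
  linarith

/-- On a ball whose radius `R` satisfies `h (R ^ c)² ≤ 1`, the square of the drift grows at most
quadratically after multiplication by `h`, with a constant that does not depend on `h`. This is what
makes the quadratic term of a drift step harmless there, although the drift grows superlinearly. -/
theorem mul_norm_drift_sq_le (hμσ : SEPCAAssumption μ σ K c) {h R : ℝ} (h0 : 0 ≤ h) (h1 : h ≤ 1)
    (hR : 1 ≤ R) (hhR : h * (R ^ c) ^ 2 ≤ 1) (x z : EuclideanSpace ℝ (Fin d)) (hx : ‖x‖ ≤ R) :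
    h * ‖μ (x, z)‖ ^ 2 ≤ 3 * (‖μ (0, 0)‖ ^ 2 + 4 * K ^ 2) * (1 + ‖x‖ ^ 2 + ‖z‖ ^ 2) := by
  have hK := hμσ.K_nonneg
  have hc := hμσ.c_nonneg
  have hRc : 1 ≤ R ^ c := Real.one_le_rpow hR hc
  have hb : ‖μ (x, z)‖ ≤ ‖μ (0, 0)‖ + K * ‖z‖ + K * (2 * R ^ c) * ‖x‖ := by
    refine (hμσ.norm_drift_le x z).trans ?_
    have : ‖x‖ ^ c ≤ R ^ c := by gcongr
    gcongr; linarith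
  set s := ‖μ (0, 0)‖
  set G := R ^ c
  calc h * ‖μ (x, z)‖ ^ 2 ≤ h * (s + K * ‖z‖ + K * (2 * G) * ‖x‖) ^ 2 := by gcongr
    _ ≤ h * (3 * (s ^ 2 + K ^ 2 * ‖z‖ ^ 2 + 4 * (K ^ 2 * G ^ 2 * ‖x‖ ^ 2))) := by
      gcongr
      linarith [sq_nonneg (s - K * ‖z‖), sq_nonneg (s - K * (2 * G) * ‖x‖),
        sq_nonneg (K * ‖z‖ - K * (2 * G) * ‖x‖)]
    _ = 3 * (h * s ^ 2 + h * (K ^ 2 * ‖z‖ ^ 2) + 4 * ((h * G ^ 2) * (K ^ 2 * ‖x‖ ^ 2))) := by ring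
    _ ≤ 3 * (1 * s ^ 2 + 1 * (K ^ 2 * ‖z‖ ^ 2) + 4 * (1 * (K ^ 2 * ‖x‖ ^ 2))) := by gcongr
    _ ≤ _ := by
      have : 0 ≤ s ^ 2 * ‖x‖ ^ 2 + s ^ 2 * ‖z‖ ^ 2 + 4 * K ^ 2 + 3 * K ^ 2 * ‖z‖ ^ 2 := by
        positivity
      linarith

end SEPCAAssumption

/-! ### Tamed drift steps -/

theorem norm_tamed_le_one {E : Type*} [NormedAddCommGroup E] [NormedSpace ℝ E] {h : ℝ}
    (h0 : 0 ≤ h) (b : E) : ‖(h / (1 + h * ‖b‖)) • b‖ ≤ 1 := by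
  rw [norm_smul, Real.norm_of_nonneg (by positivity), div_mul_eq_mul_div]
  exact div_le_one_of_le₀ (by linarith) (by positivity)

/-- If `⟪y, b⟫` and `h ‖b‖²` are both bounded by multiples of `L`, then a tamed drift step increases
`‖y‖²` by at most a multiple of `h L`. -/
theorem norm_add_tamed_sq_le {E : Type*} [NormedAddCommGroup E] [InnerProductSpace ℝ E]
    {h A₁ A₂ L : ℝ} (h0 : 0 ≤ h) (hA₁ : 0 ≤ A₁ * L) (y b : E) (hb : inner ℝ y b ≤ A₁ * L)
    (hb2 : h * ‖b‖ ^ 2 ≤ A₂ * L) :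
    ‖y + (h / (1 + h * ‖b‖)) • b‖ ^ 2 ≤ ‖y‖ ^ 2 + h * ((2 * A₁ + A₂) * L) := by
  have hden : 1 ≤ 1 + h * ‖b‖ := by linarith [show 0 ≤ h * ‖b‖ by positivity]
  set η := h / (1 + h * ‖b‖)
  have hη0 : 0 ≤ η := by positivity
  have hη : η ≤ h := div_le_self h0 hden
  rw [norm_add_sq_real, inner_smul_right, norm_smul, Real.norm_of_nonneg hη0]
  have e1 : η * inner ℝ y b ≤ h * (A₁ * L) :=
    (mul_le_mul_of_nonneg_left hb hη0).trans (mul_le_mul_of_nonneg_right hη hA₁)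
  have e2 : (η * ‖b‖) ^ 2 ≤ h * (A₂ * L) := by
    calc (η * ‖b‖) ^ 2 ≤ (h * ‖b‖) ^ 2 := by gcongr
      _ = h * (h * ‖b‖ ^ 2) := by ring
      _ ≤ _ := by gcongr
  linarith

/-! ### Euler schemes driven by Brownian motion -/

/-- Moment bounds up to time `T` for Euler type schemes driven by a Brownian motion, with a constant
that does not depend on the number `m` of steps per unit of time. -/
theorem exists_euler_moment_bound {Ω : Type*} {mΩ : MeasurableSpace Ω} {P : Measure Ω}
    [IsProbabilityMeasure P] {𝓕 : Filtration ℝ≥0 mΩ} {r : ℕ}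
    {B : ℝ≥0 → Ω → EuclideanSpace ℝ (Fin r)} (hB : IsFilteredBrownianMotion P 𝓕 B)
    {E : Type*} [NormedAddCommGroup E] [InnerProductSpace ℝ E] [CompleteSpace E]
    {A T : ℝ} (hA : 0 ≤ A) (q : ℕ) :
    ∃ C : ℝ, 0 ≤ C ∧ ∀ (m : ℕ) (ρ : ℝ) (Y V : ℕ → Ω → E)
      (S : ℕ → Ω → EuclideanSpace ℝ (Fin r) →L[ℝ] E) (κ : ℕ → ℕ), 1 ≤ m →
      (∀ n : ℕ, StronglyMeasurable[𝓕 ((n : ℝ≥0) / m)] (Y n)) →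
      (∀ n : ℕ, StronglyMeasurable[𝓕 ((n : ℝ≥0) / m)] (V n)) →
      (∀ n : ℕ, StronglyMeasurable[𝓕 ((n : ℝ≥0) / m)] (S n)) →
      (∀ n, κ n ≤ n) →
      (∀ n ω, Y (n + 1) ω = V n ω +
        S n ω (B (((n + 1 : ℕ) : ℝ≥0) / (m : ℝ≥0)) ω - B ((n : ℝ≥0) / (m : ℝ≥0)) ω)) →
      (∀ n ω, ‖V n ω‖ ^ 2 ≤
        ‖Y n ω‖ ^ 2 + 1 / (m : ℝ) * (A * (ρ ^ 2 + ‖Y n ω‖ ^ 2 + ‖Y (κ n) ω‖ ^ 2))) →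
      (∀ n ω, ‖S n ω‖ ^ 2 ≤ A * (ρ ^ 2 + ‖Y n ω‖ ^ 2 + ‖Y (κ n) ω‖ ^ 2)) →
      Integrable (fun ω => ‖Y 0 ω‖ ^ (2 * (q + 1))) P →
      ∀ n : ℕ, (n : ℝ) ≤ T * m → Integrable (fun ω => ‖Y n ω‖ ^ (2 * (q + 1))) P ∧
        ∫ ω, ‖Y n ω‖ ^ (2 * (q + 1)) ∂P ≤
          C * (ρ ^ (2 * (q + 1)) + ∫ ω, ‖Y 0 ω‖ ^ (2 * (q + 1)) ∂P) := by
  set M : ℝ := 2 ^ (2 * q + 1) * (1 + r ^ q * (r * ∫ x, x ^ (2 * (q + 1)) ∂(gaussianReal 0 1)))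
  have hM : 0 ≤ M := by
    have : 0 ≤ ∫ x, x ^ (2 * (q + 1)) ∂(gaussianReal 0 1) :=
      integral_nonneg fun x => by rw [pow_mul]; positivity
    positivity
  set C : ℝ := 2 * 4 ^ q * (A * (1 + A) ^ q * ((q + 1) + (q + 1) * (3 * q + 1) * M)) with hC
  have hC0 : 0 ≤ C := by positivity
  refine ⟨Real.exp (C * T), (Real.exp_pos _).le, ?_⟩
  intro m ρ Y V S κ hm hY hV hS hκ hYsucc hVL hSL hY0 n hn
  have hm0 : (0 : ℝ≥0) < m := by exact_mod_cast hm
  have hmR : (0 : ℝ) < m := by exact_mod_cast hm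
  have ht : ∀ n : ℕ, ((n + 1 : ℕ) : ℝ≥0) / (m : ℝ≥0) = (n : ℝ≥0) / m + 1 / m := fun n => by
    push_cast; rw [add_div]
  have hh0 : (0 : ℝ≥0) < 1 / m := by positivity
  have hh1 : (1 : ℝ≥0) / m ≤ 1 := div_le_one_of_le₀ (by exact_mod_cast hm) hm0.le
  have hh1' : 1 / (m : ℝ) ≤ 1 := by exact_mod_cast hh1
  have hρ : 0 ≤ ρ ^ (2 * (q + 1)) := by rw [pow_mul]; positivity
  simp_rw [ht] at hYsucc
  have hmom := fun n : ℕ =>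
    hB.integrable_and_integral_increment_le ((n : ℝ≥0) / m) hh0 hh1 q
  obtain ⟨hint, hle⟩ := moment_recursion (P := P) (𝓖 := fun n : ℕ => 𝓕 ((n : ℝ≥0) / m))
    (W := fun n ω => B ((n : ℝ≥0) / m + 1 / m) ω - B ((n : ℝ≥0) / m) ω) (κ := κ)
    (fun n => 𝓕.le _) (fun a b hab => 𝓕.mono (by gcongr)) hY hV hS hκ hYsucc
    (fun n => hB.indep_increment _ _ le_self_add) (by positivity) hh1' hA hM hVL hSL
    (fun n => hB.integrable_increment _ _) (fun n => hB.integral_increment _ _)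
    (fun n => (hmom n).1) (fun n => by simpa using (hmom n).2) hY0 n
  refine ⟨hint, (le_add_of_nonneg_left hρ).trans (hle.trans ?_)⟩
  have h0 : 0 ≤ ∫ ω, ‖Y 0 ω‖ ^ (2 * (q + 1)) ∂P := integral_nonneg fun ω => by positivity
  gcongr
  refine one_add_mul_pow_le_exp (by positivity) hC0 ?_
  rw [mul_one_div]
  exact (div_le_iff₀ hmR).2 hn

/-! ### Stopping on exit from a ball -/

/-- The process `y` stopped at the first time at which its norm exceeds `R`. The value at that time,
with norm larger than `R`, is the one at which the process is frozen. -/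
noncomputable def stoppedOutside {Ω E : Type*} [Norm E] (R : ℝ) (y : ℕ → Ω → E) : ℕ → Ω → E
  | 0, ω => y 0 ω
  | n + 1, ω => open Classical in
    if ∀ k ≤ n, ‖y k ω‖ ≤ R then y (n + 1) ω else stoppedOutside R y n ω

section stoppedOutside

variable {Ω E : Type*} [NormedAddCommGroup E] {R : ℝ} {y : ℕ → Ω → E} {n : ℕ} {ω : Ω}

theorem stoppedOutside_eq (h : ∀ k < n, ‖y k ω‖ ≤ R) : stoppedOutside R y n ω = y n ω := by
  cases n with
  | zero => rfl
  | succ n => exact if_pos fun k hk => h k (Nat.lt_succ_of_le hk)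

/-- Since the stopped process is frozen outside the ball, the event that `y` left the ball up to
time `n` is seen from the value of the stopped process at time `n` alone, so no maximal inequality
is needed to estimate its probability. -/
theorem lt_norm_stoppedOutside (h : ¬ ∀ k ≤ n, ‖y k ω‖ ≤ R) : R < ‖stoppedOutside R y n ω‖ := by
  induction n with
  | zero => simpa [stoppedOutside] using h
  | succ n ih =>
    by_cases hn : ∀ k ≤ n, ‖y k ω‖ ≤ R
    · rw [stoppedOutside, if_pos hn]
      by_contra! hlt
      refine h fun k hk => ?_
      rcases Nat.le_succ_iff.1 hk with hk | rfl
      · exact hn k hk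
      · exact hlt
    · rw [stoppedOutside, if_neg hn]
      exact ih hn

theorem measurableSet_forall_norm_le {𝓖 : MeasurableSpace Ω}
    (hy : ∀ k ≤ n, StronglyMeasurable[𝓖] (y k)) (R : ℝ) :
    MeasurableSet[𝓖] {ω | ∀ k ≤ n, ‖y k ω‖ ≤ R} := by
  simp only [Set.ofPred_forall]
  exact MeasurableSet.iInter fun k => MeasurableSet.iInter fun hk =>
    measurableSet_le (hy k hk).norm.measurable measurable_const

theorem stronglyMeasurable_stoppedOutside {𝓖 : ℕ → MeasurableSpace Ω} (h𝓖 : Monotone 𝓖)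
    (hy : ∀ n, StronglyMeasurable[𝓖 n] (y n)) (n : ℕ) :
    StronglyMeasurable[𝓖 n] (stoppedOutside R y n) := by
  induction n with
  | zero => exact hy 0
  | succ n ih =>
    exact StronglyMeasurable.ite
      (measurableSet_forall_norm_le (fun k hk => (hy k).mono (h𝓖 (by omega))) R)
      (hy (n + 1)) (ih.mono (h𝓖 n.le_succ))

end stoppedOutside

/-! ### Bounds for the tamed Euler scheme -/

section tamedEuler

variable {Ω : Type*} {mΩ : MeasurableSpace Ω} {P : Measure Ω}
    {𝓕 : Filtration ℝ≥0 mΩ} {d r : ℕ} {B : ℝ≥0 → Ω → EuclideanSpace ℝ (Fin r)}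
    {μ : EuclideanSpace ℝ (Fin d) × EuclideanSpace ℝ (Fin d) → EuclideanSpace ℝ (Fin d)}
    {σ : EuclideanSpace ℝ (Fin d) × EuclideanSpace ℝ (Fin d) →
      (EuclideanSpace ℝ (Fin r) →L[ℝ] EuclideanSpace ℝ (Fin d))}
    {K c : ℝ} {ξ : Ω → EuclideanSpace ℝ (Fin d)}

theorem stronglyMeasurable_tamed {𝓖 : MeasurableSpace Ω} (hμ : Continuous μ)
    {y z : Ω → EuclideanSpace ℝ (Fin d)} (hy : StronglyMeasurable[𝓖] y)
    (hz : StronglyMeasurable[𝓖] z) {h : ℝ} (h0 : 0 ≤ h) :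
    StronglyMeasurable[𝓖] fun ω =>
      y ω + (h / (1 + h * ‖μ (y ω, z ω)‖)) • μ (y ω, z ω) := by
  have hc : Continuous fun p : EuclideanSpace ℝ (Fin d) × EuclideanSpace ℝ (Fin d) =>
      p.1 + (h / (1 + h * ‖μ p‖)) • μ p := by
    refine continuous_fst.add (Continuous.smul (continuous_const.div
      (continuous_const.add (continuous_const.mul hμ.norm)) fun p => ?_) hμ)
    exact (show 0 < 1 + h * ‖μ p‖ by positivity).ne'
  exact hc.comp_stronglyMeasurable (hy.prodMk hz)

theorem stronglyMeasurable_tamedEuler (hB : StronglyAdapted 𝓕 B) (hμ : Continuous μ)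
    (hσ : Continuous σ) (hξ : StronglyMeasurable[𝓕 0] ξ) (m n : ℕ) :
    StronglyMeasurable[𝓕 ((n : ℝ≥0) / m)] (tamedEuler μ σ ξ B m n) := by
  induction n using Nat.strong_induction_on with
  | _ n ih =>
    rcases n with _ | n
    · have e : tamedEuler μ σ ξ B m 0 = ξ := funext fun ω => tamedEuler_zero μ σ ξ B m ω
      rw [e]
      exact hξ.mono (𝓕.mono (by positivity))
    have hmono : ∀ k ≤ n + 1, 𝓕 ((k : ℝ≥0) / m) ≤ 𝓕 (((n + 1 : ℕ) : ℝ≥0) / m) := fun k hk =>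
      𝓕.mono (by gcongr)
    have hκ : n / m * m ≤ n := Nat.div_mul_le_self n m
    have hy := (ih n n.lt_succ_self).mono (hmono n n.le_succ)
    have hz := (ih (n / m * m) (by omega)).mono (hmono _ (by omega))
    have hW := (hB (((n + 1 : ℕ) : ℝ≥0) / m)).sub ((hB ((n : ℝ≥0) / m)).mono (hmono n n.le_succ))
    have hS := hσ.comp_stronglyMeasurable (hy.prodMk hz)
    have hSW := Continuous.comp_stronglyMeasurable (g := fun p :
      (EuclideanSpace ℝ (Fin r) →L[ℝ] EuclideanSpace ℝ (Fin d)) × EuclideanSpace ℝ (Fin r) =>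
        p.1 p.2) (by fun_prop) (hS.prodMk hW)
    have := (stronglyMeasurable_tamed hμ hy hz (h := 1 / (m : ℝ)) (by positivity)).add hSW
    rw [show tamedEuler μ σ ξ B m (n + 1) = _ from funext (tamedEuler_succ μ σ ξ B m n)]
    exact this

/-- The moments of order `2 (q + 1)` of the tamed scheme grow at most like `m ^ (2 (q + 1))`. The
tamed drift increment has norm at most `1`, and there are at most `T m` of them. -/
theorem exists_tamedEuler_crude_bound [IsProbabilityMeasure P]
    (hB : IsFilteredBrownianMotion P 𝓕 B) (hμσ : SEPCAAssumption μ σ K c)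
    (hξ : StronglyMeasurable[𝓕 0] ξ) (T : ℝ) (q : ℕ)
    (hξq : Integrable (fun ω => ‖ξ ω‖ ^ (2 * (q + 1))) P) :
    ∃ C : ℝ, 0 ≤ C ∧ ∀ m n : ℕ, 1 ≤ m → (n : ℝ) ≤ T * m →
      Integrable (fun ω => ‖tamedEuler μ σ ξ B m n ω‖ ^ (2 * (q + 1))) P ∧
      ∫ ω, ‖tamedEuler μ σ ξ B m n ω‖ ^ (2 * (q + 1)) ∂P ≤ C * (m : ℝ) ^ (2 * (q + 1)) := by
  obtain ⟨C, hC, hb⟩ := exists_euler_moment_bound hB (E := EuclideanSpace ℝ (Fin d)) (T := T)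
    (A := 3 * (‖σ (0, 0)‖ ^ 2 + K ^ 2) + 2) (by positivity) q
  have hI : 0 ≤ ∫ ω, ‖ξ ω‖ ^ (2 * (q + 1)) ∂P := integral_nonneg fun ω => by positivity
  refine ⟨C * (1 + ∫ ω, ‖ξ ω‖ ^ (2 * (q + 1)) ∂P), by positivity, fun m n hm hn => ?_⟩
  have hm1 : (1 : ℝ) ≤ m := by exact_mod_cast hm
  have hμc := hμσ.contDiff_drift.continuous
  have hσc := hμσ.continuous_diffusion
  have hy := stronglyMeasurable_tamedEuler hB.adapted hμc hσc hξ m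
  have hz : ∀ n : ℕ, StronglyMeasurable[𝓕 ((n : ℝ≥0) / m)] (tamedEuler μ σ ξ B m (n / m * m)) :=
    fun n => (hy (n / m * m)).mono (𝓕.mono (by gcongr; exact Nat.div_mul_le_self n m))
  obtain ⟨hint, hle⟩ := hb m m (tamedEuler μ σ ξ B m)
    (fun n ω => tamedEuler μ σ ξ B m n ω
        + ((1 / (m : ℝ)) / (1 + (1 / (m : ℝ)) *
            ‖μ (tamedEuler μ σ ξ B m n ω, tamedEuler μ σ ξ B m (n / m * m) ω)‖)) •
            μ (tamedEuler μ σ ξ B m n ω, tamedEuler μ σ ξ B m (n / m * m) ω))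
    (fun n ω => σ (tamedEuler μ σ ξ B m n ω, tamedEuler μ σ ξ B m (n / m * m) ω))
    (fun n => n / m * m) hm hy
    (fun n => stronglyMeasurable_tamed hμc (hy n) (hz n) (by positivity))
    (fun n => hσc.comp_stronglyMeasurable ((hy n).prodMk (hz n)))
    (fun n => Nat.div_mul_le_self n m) (fun n ω => tamedEuler_succ μ σ ξ B m n ω)
    (fun n ω => by
      have h1 := norm_tamed_le_one (h := 1 / (m : ℝ)) (by positivity)
        (μ (tamedEuler μ σ ξ B m n ω, tamedEuler μ σ ξ B m (n / m * m) ω))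
      have h2 := (norm_add_le (tamedEuler μ σ ξ B m n ω) _).trans (add_le_add_right h1 _)
      refine (pow_le_pow_left₀ (norm_nonneg _) h2 2).trans ?_
      set a := ‖tamedEuler μ σ ξ B m n ω‖
      set b := ‖tamedEuler μ σ ξ B m (n / m * m) ω‖
      -- With `h = 1 / m`, `2 a = h * (2 m a) ≤ h * (m² + a²)` and `1 ≤ h * m²`: an increment of
      -- norm `1` is admissible in the recursion when `ρ = m`.
      have h3 : 2 * a + 1 ≤ 1 / (m : ℝ) * (2 * ((m : ℝ) ^ 2 + a ^ 2 + b ^ 2)) := by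
        rw [one_div_mul_eq_div, le_div_iff₀ (by positivity)]
        nlinarith [sq_nonneg (a - m), sq_nonneg a, sq_nonneg b]
      have h4 : 1 / (m : ℝ) * (2 * ((m : ℝ) ^ 2 + a ^ 2 + b ^ 2)) ≤ 1 / (m : ℝ) *
          ((3 * (‖σ (0, 0)‖ ^ 2 + K ^ 2) + 2) * ((m : ℝ) ^ 2 + a ^ 2 + b ^ 2)) := by
        gcongr
        linarith [show 0 ≤ 3 * (‖σ (0, 0)‖ ^ 2 + K ^ 2) by positivity]
      linarith)
    (fun n ω => (hμσ.norm_diffusion_sq_le hm1 _ _).trans (by gcongr; linarith))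
    (by simpa only [tamedEuler_zero] using hξq) n hn
  refine ⟨hint, hle.trans ?_⟩
  simp only [tamedEuler_zero]
  have : 1 ≤ (m : ℝ) ^ (2 * (q + 1)) := one_le_pow₀ hm1
  rw [mul_assoc]
  gcongr
  nlinarith

/-- The tamed scheme stopped on leaving the ball of radius `R` has moments that are bounded
uniformly in `m`, as long as `(R ^ c)² ≤ m`. -/
theorem exists_stopped_tamedEuler_bound [IsProbabilityMeasure P]
    (hB : IsFilteredBrownianMotion P 𝓕 B) (hμσ : SEPCAAssumption μ σ K c)
    (hξ : StronglyMeasurable[𝓕 0] ξ) (T : ℝ) (q : ℕ)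
    (hξq : Integrable (fun ω => ‖ξ ω‖ ^ (2 * (q + 1))) P) :
    ∃ C : ℝ, 0 ≤ C ∧ ∀ (m n : ℕ) (R : ℝ), 1 ≤ m → (n : ℝ) ≤ T * m → 1 ≤ R → (R ^ c) ^ 2 ≤ m →
      Integrable (fun ω => ‖stoppedOutside R (tamedEuler μ σ ξ B m) n ω‖ ^ (2 * (q + 1))) P ∧
      ∫ ω, ‖stoppedOutside R (tamedEuler μ σ ξ B m) n ω‖ ^ (2 * (q + 1)) ∂P ≤ C := by
  have hK := hμσ.K_nonneg
  set A₀ : ℝ := 3 * (‖σ (0, 0)‖ ^ 2 + K ^ 2)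
  set A₁ : ℝ := 2 * K + ‖μ (0, 0)‖
  set A₂ : ℝ := 3 * (‖μ (0, 0)‖ ^ 2 + 4 * K ^ 2)
  have hA₀0 : 0 ≤ A₀ := by positivity
  have hA₁0 : 0 ≤ A₁ := by positivity
  have hA₂0 : 0 ≤ A₂ := by positivity
  obtain ⟨C, hC, hb⟩ := exists_euler_moment_bound hB (E := EuclideanSpace ℝ (Fin d)) (T := T)
    (A := A₀ + (2 * A₁ + A₂)) (by positivity) q
  have hI : 0 ≤ ∫ ω, ‖ξ ω‖ ^ (2 * (q + 1)) ∂P := integral_nonneg fun ω => by positivity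
  refine ⟨C * (1 + ∫ ω, ‖ξ ω‖ ^ (2 * (q + 1)) ∂P), by positivity, fun m n R hm hn hR hRm => ?_⟩
  have hm1 : (1 : ℝ) ≤ m := by exact_mod_cast hm
  have hh1 : 1 / (m : ℝ) ≤ 1 := div_le_one_of_le₀ hm1 (by positivity)
  have hhR : 1 / (m : ℝ) * (R ^ c) ^ 2 ≤ 1 := by
    rw [one_div_mul_eq_div]; exact div_le_one_of_le₀ hRm (by positivity)
  have hμc := hμσ.contDiff_drift.continuous
  have hσc := hμσ.continuous_diffusion
  set y := tamedEuler μ σ ξ B m with hydef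
  have hκ : ∀ n, n / m * m ≤ n := fun n => Nat.div_mul_le_self n m
  have hmono : Monotone fun n : ℕ => 𝓕 ((n : ℝ≥0) / m) := fun a b hab => 𝓕.mono (by gcongr)
  have hy : ∀ n : ℕ, StronglyMeasurable[𝓕 ((n : ℝ≥0) / m)] (y n) :=
    stronglyMeasurable_tamedEuler hB.adapted hμc hσc hξ m
  have hz : ∀ n : ℕ, StronglyMeasurable[𝓕 ((n : ℝ≥0) / m)] (y (n / m * m)) :=
    fun n => (hy (n / m * m)).mono (hmono (hκ n))
  have hY := stronglyMeasurable_stoppedOutside (R := R) hmono hy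
  have hG : ∀ n : ℕ, MeasurableSet[𝓕 ((n : ℝ≥0) / m)] {ω | ∀ k ≤ n, ‖y k ω‖ ≤ R} := fun n =>
    measurableSet_forall_norm_le (fun k hk => (hy k).mono (hmono hk)) R
  have hYy : ∀ {n ω}, (∀ k ≤ n, ‖y k ω‖ ≤ R) → ∀ k ≤ n, stoppedOutside R y k ω = y k ω :=
    fun h k hk => stoppedOutside_eq fun j hj => h j (by omega)
  classical
  obtain ⟨hint, hle⟩ := hb m 1 (stoppedOutside R y)
    -- After the exit the step is the trivial one, with the value itself as drift part and no noise.
    (fun n ω => if ∀ k ≤ n, ‖y k ω‖ ≤ R then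
      y n ω + ((1 / (m : ℝ)) / (1 + (1 / (m : ℝ)) *
        ‖μ (y n ω, y (n / m * m) ω)‖)) • μ (y n ω, y (n / m * m) ω)
      else stoppedOutside R y n ω)
    (fun n ω => if ∀ k ≤ n, ‖y k ω‖ ≤ R then σ (y n ω, y (n / m * m) ω) else 0)
    (fun n => n / m * m) hm hY
    (fun n => StronglyMeasurable.ite (hG n)
      (stronglyMeasurable_tamed hμc (hy n) (hz n) (by positivity)) (hY n))
    (fun n => StronglyMeasurable.ite (hG n)
      (hσc.comp_stronglyMeasurable ((hy n).prodMk (hz n))) stronglyMeasurable_const)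
    hκ
    (fun n ω => by
      by_cases h : ∀ k ≤ n, ‖y k ω‖ ≤ R
      · rw [if_pos h, if_pos h, stoppedOutside, if_pos h, hydef]
        exact tamedEuler_succ μ σ ξ B m n ω
      · rw [if_neg h, if_neg h, stoppedOutside, if_neg h]
        simp)
    (fun n ω => by
      by_cases h : ∀ k ≤ n, ‖y k ω‖ ≤ R
      · simp only [if_pos h, hYy h n le_rfl, hYy h _ (hκ n)]
        refine (norm_add_tamed_sq_le (A₁ := A₁) (A₂ := A₂)
          (L := 1 ^ 2 + ‖y n ω‖ ^ 2 + ‖y (n / m * m) ω‖ ^ 2) (by positivity)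
          (by positivity) _ _ ?_ ?_).trans ?_
        · rw [one_pow]; exact hμσ.inner_drift_le _ _
        · rw [one_pow]
          exact hμσ.mul_norm_drift_sq_le (by positivity) hh1 hR hhR _ _ (h n le_rfl)
        · have hA : 2 * A₁ + A₂ ≤ A₀ + (2 * A₁ + A₂) := by linarith
          gcongr
      · simp only [if_neg h]
        exact le_add_of_nonneg_right (by positivity))
    (fun n ω => by
      by_cases h : ∀ k ≤ n, ‖y k ω‖ ≤ R
      · simp only [if_pos h, hYy h n le_rfl, hYy h _ (hκ n)]
        exact (hμσ.norm_diffusion_sq_le le_rfl _ _).trans (by gcongr; linarith)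
      · simp only [if_neg h, norm_zero, zero_pow two_ne_zero]
        positivity)
    (by simpa only [stoppedOutside, hydef, tamedEuler_zero] using hξq) n hn
  refine ⟨hint, hle.trans_eq ?_⟩
  simp only [stoppedOutside, hydef, tamedEuler_zero, one_pow]

end tamedEuler

/-- The tamed Euler iterates have uniformly bounded moments of every order `p ≥ 1`. -/
theorem theorem3p6 {Ω : Type*} {mΩ : MeasurableSpace Ω} (P : Measure Ω) [IsProbabilityMeasure P]
    (𝓕 : Filtration ℝ≥0 mΩ) {d r : ℕ}
    (B : ℝ≥0 → Ω → EuclideanSpace ℝ (Fin r)) (hB : IsFilteredBrownianMotion P 𝓕 B)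
    (μ : EuclideanSpace ℝ (Fin d) × EuclideanSpace ℝ (Fin d) → EuclideanSpace ℝ (Fin d))
    (σ : EuclideanSpace ℝ (Fin d) × EuclideanSpace ℝ (Fin d) →
      (EuclideanSpace ℝ (Fin r) →L[ℝ] EuclideanSpace ℝ (Fin d)))
    (K c : ℝ) (hμσ : SEPCAAssumption μ σ K c)
    (ξ : Ω → EuclideanSpace ℝ (Fin d)) (hξ_meas : StronglyMeasurable[𝓕 0] ξ)
    (hξ_moments : ∀ q : ℝ, 1 ≤ q → MemLp ξ (ENNReal.ofReal q) P)
    (T : ℝ) (hT : 0 ≤ T) (p : ℝ) (hp : 1 ≤ p) :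
    (⨆ (m : ℕ) (_ : 1 ≤ m) (n : ℕ) (_ : (n : ℝ) ≤ T * m),
      ∫⁻ ω, ‖tamedEuler μ σ ξ B m n ω‖ₑ ^ p ∂P) < ∞ := by
  have hc := hμσ.c_nonneg
  have hξ : ∀ q : ℕ, Integrable (fun ω => ‖ξ ω‖ ^ (2 * (q + 1))) P := fun q => by
    have h := hξ_moments (2 * (q + 1) : ℕ) (by exact_mod_cast (by omega : 1 ≤ 2 * (q + 1)))
    rw [ENNReal.ofReal_natCast] at h
    exact h.integrable_norm_pow (by positivity)
  -- It suffices to bound the even moment of order `2 (q + 1) ≥ p`.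
  set q := ⌈p⌉₊
  have hpq : p ≤ (2 * (q + 1) : ℕ) := by
    have := Nat.le_ceil p
    push_cast
    linarith
  -- `Q` is so large that `m ^ (2 (q + 1)) ≤ R ^ (Q + 1)` for `R = m ^ (1 / (2 (c + 1)))`.
  set Q := ⌈4 * (q + 1) * (c + 1)⌉₊ with hQ
  obtain ⟨C₁, hC₁, hb₁⟩ := exists_tamedEuler_crude_bound hB hμσ hξ_meas T (2 * q + 1) (hξ _)
  obtain ⟨C₂, hC₂, hb₂⟩ := exists_stopped_tamedEuler_bound hB hμσ hξ_meas T q (hξ _)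
  obtain ⟨C₃, hC₃, hb₃⟩ := exists_stopped_tamedEuler_bound hB hμσ hξ_meas T Q (hξ _)
  refine lt_of_le_of_lt (b := ENNReal.ofReal (1 + (C₂ + C₁ + C₃))) ?_ ENNReal.ofReal_lt_top
  refine iSup₂_le fun m hm => iSup₂_le fun n hn => ?_
  have hm1 : (1 : ℝ) ≤ m := by exact_mod_cast hm
  have hm0 : (0 : ℝ) < m := by linarith
  set R : ℝ := (m : ℝ) ^ (1 / (2 * (c + 1))) with hRdef
  have hR : 1 ≤ R := Real.one_le_rpow hm1 (by positivity)
  have hRc : (R ^ c) ^ 2 ≤ m := by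
    rw [hRdef, ← Real.rpow_mul hm0.le, ← Real.rpow_mul_natCast hm0.le]
    refine (Real.rpow_le_rpow_of_exponent_le hm1 (y := 1 / (2 * (c + 1)) * c * (2 : ℕ)) (z := 1)
      ?_).trans_eq (Real.rpow_one _)
    rw [show 1 / (2 * (c + 1)) * c * (2 : ℕ) = c / (c + 1) by push_cast; field_simp]
    exact div_le_one_of_le₀ (by linarith) (by linarith)
  have hRQ : (m : ℝ) ^ (2 * (q + 1)) ≤ R ^ (Q + 1) := by
    rw [hRdef, ← Real.rpow_mul_natCast hm0.le, ← Real.rpow_natCast]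
    refine Real.rpow_le_rpow_of_exponent_le hm1 ?_
    have hQle := Nat.le_ceil (4 * (q + 1) * (c + 1))
    rw [← hQ] at hQle
    rw [one_div_mul_eq_div, le_div_iff₀ (by positivity)]
    push_cast
    linarith
  obtain ⟨hi₁, hle₁⟩ := hb₁ m n hm hn
  obtain ⟨hi₂, hle₂⟩ := hb₂ m n R hm hn hR hRc
  obtain ⟨hi₃, hle₃⟩ := hb₃ m n R hm hn hR hRc
  rw [show 2 * (2 * q + 1 + 1) = 2 * (q + 1) * 2 by ring] at hi₁ hle₁
  set y := tamedEuler μ σ ξ B m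
  set Y := stoppedOutside R y
  have hpt : ∀ ω, ‖y n ω‖ ^ p ≤ 1 + (‖Y n ω‖ ^ (2 * (q + 1))
      + ‖y n ω‖ ^ (2 * (q + 1) * 2) / (m : ℝ) ^ (2 * (q + 1) * 2) + ‖Y n ω‖ ^ (2 * (Q + 1))) := by
    intro ω
    have h1 : ‖y n ω‖ ^ p ≤ 1 + ‖y n ω‖ ^ (2 * (q + 1)) := by
      rcases le_total ‖y n ω‖ 1 with h | h
      · have := Real.rpow_le_one (norm_nonneg (y n ω)) h (by linarith : 0 ≤ p)
        linarith [show 0 ≤ ‖y n ω‖ ^ (2 * (q + 1)) by positivity]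
      · have := Real.rpow_le_rpow_of_exponent_le h hpq
        rw [Real.rpow_natCast] at this
        linarith
    refine h1.trans (add_le_add le_rfl ?_)
    by_cases hg : ∀ k ≤ n, ‖y k ω‖ ≤ R
    · rw [show Y n ω = y n ω from stoppedOutside_eq fun k hk => hg k hk.le, add_assoc]
      exact le_add_of_nonneg_right (by positivity)
    -- Off the good event `a ≤ a * (b / N)`, since `N ≤ b` there, and the product splits by
    -- `2 x y ≤ x² + y²` with `x = a / N`, `y = b`: the crude bound controls the first square, the
    -- stopped scheme the second.
    · have hRY : R < ‖Y n ω‖ := lt_norm_stoppedOutside hg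
      have hb : (m : ℝ) ^ (2 * (q + 1)) ≤ ‖Y n ω‖ ^ (Q + 1) :=
        hRQ.trans (by gcongr)
      set a := ‖y n ω‖ ^ (2 * (q + 1)) with ha
      set b := ‖Y n ω‖ ^ (Q + 1) with hbdef
      set N := (m : ℝ) ^ (2 * (q + 1)) with hN
      have hN0 : 0 < N := by positivity
      have ha0 : 0 ≤ a := by positivity
      have e1 : ‖y n ω‖ ^ (2 * (q + 1) * 2) / (m : ℝ) ^ (2 * (q + 1) * 2) = (a / N) ^ 2 := by
        rw [div_pow, ha, hN, ← pow_mul, ← pow_mul]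
      have e2 : ‖Y n ω‖ ^ (2 * (Q + 1)) = b ^ 2 := by rw [hbdef, ← pow_mul, mul_comm]
      rw [e1, e2]
      have h2 : a ≤ a / N * b := by
        calc a = a / N * N := by field_simp
          _ ≤ a / N * b := by gcongr
      have h3 : 0 ≤ ‖Y n ω‖ ^ (2 * (q + 1)) := by positivity
      nlinarith [sq_nonneg (a / N - b), sq_nonneg (a / N), sq_nonneg b]
  have hi₁' := hi₁.div_const ((m : ℝ) ^ (2 * (q + 1) * 2))
  have hi₂₁ : Integrable (fun ω => ‖Y n ω‖ ^ (2 * (q + 1))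
      + ‖y n ω‖ ^ (2 * (q + 1) * 2) / (m : ℝ) ^ (2 * (q + 1) * 2)) P := hi₂.add hi₁'
  have hi₂₁₃ : Integrable (fun ω => ‖Y n ω‖ ^ (2 * (q + 1))
      + ‖y n ω‖ ^ (2 * (q + 1) * 2) / (m : ℝ) ^ (2 * (q + 1) * 2) + ‖Y n ω‖ ^ (2 * (Q + 1))) P :=
    hi₂₁.add hi₃
  have hi0 := integrable_const (μ := P) (1 : ℝ)
  calc ∫⁻ ω, ‖y n ω‖ₑ ^ p ∂P ≤ ∫⁻ ω, ENNReal.ofReal (1 + (‖Y n ω‖ ^ (2 * (q + 1))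
      + ‖y n ω‖ ^ (2 * (q + 1) * 2) / (m : ℝ) ^ (2 * (q + 1) * 2)
      + ‖Y n ω‖ ^ (2 * (Q + 1)))) ∂P := by
        refine lintegral_mono fun ω => ?_
        rw [← ofReal_norm, ENNReal.ofReal_rpow_of_nonneg (norm_nonneg _) (by linarith)]
        exact ENNReal.ofReal_le_ofReal (hpt ω)
    _ = ENNReal.ofReal (∫ ω, (1 + (‖Y n ω‖ ^ (2 * (q + 1))
      + ‖y n ω‖ ^ (2 * (q + 1) * 2) / (m : ℝ) ^ (2 * (q + 1) * 2)
      + ‖Y n ω‖ ^ (2 * (Q + 1)))) ∂P) :=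
        (ofReal_integral_eq_lintegral_ofReal (hi0.add hi₂₁₃)
          (ae_of_all _ fun ω => by simp only [Pi.zero_apply, Pi.add_apply]; positivity)).symm
    _ ≤ _ := by
        refine ENNReal.ofReal_le_ofReal ?_
        rw [integral_add hi0 hi₂₁₃, integral_add hi₂₁ hi₃, integral_add hi₂ hi₁',
          integral_div, integral_const, probReal_univ, one_smul]
        have : (∫ ω, ‖y n ω‖ ^ (2 * (q + 1) * 2) ∂P) / (m : ℝ) ^ (2 * (q + 1) * 2) ≤ C₁ :=
          (div_le_iff₀ (by positivity)).2 hle₁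
        linarith
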